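/- Let $C_n$ be a cyclic group of order $n\ge 1$, let $S\le \mathrm{Aut}(C_n)$ and let $$1\to C_n\xrightarrow{\iota} G\xrightarrow{\pi} S\to 1$$ be an exact sequence of groups, where $\iota$ is an inclusion and $\pi(g)$ is the automorphism of $C_n$ induced by conjugation by $g$, for all $g\in G$. Suppose that the exponent of $2$ in the prime factorization of $n$ is not equal to $2$. Notation and definitions. For a prime $p$ let $p^{k}$ be the exact power of $p$ dividing $n$ and let $C_{p^{k}}$ be the $p$-primary part of $C_n$. If $k\ge 2$, let $\alpha_p\in\mathrm{Aut}(C_n)$ be the automorphism which sends a generator $g_p$ of $C_{p^{k}}$ to $g_p^{1+p^{k-1}}$ and fixes the other primary parts of $C_n$ elementwise. Let $S_p\le\mathrm{Aut}(C_n)$ be the image of $S$ under the projection of $\mathrm{Aut}(C_n)=\prod_q \mathrm{Aut}(C_{q^{k_q}})$ onto the factor for $q=p$, this factor being regarded as the subgroup of the automorphisms of $C_n$ that act trivially on the other primary parts. A finite group is a \emph{Roquette group} if all its normal abelian subgroups are cyclic. A subgroup $T$ of a finite group $G$ is \emph{expansive} if, for every $g\in G\setminus N_G(T)$, the $N_G(T)$-core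 of the subgroup $({}^gT\cap N_G(T))\,T$ properly contains $T$. (For $H\le N$, the $N$-core of $H$ is the largest subgroup of $H$ that is normal in $N$.) Then: 1. If $G$ is a Roquette group, then for every prime $p$ with $p^2\mid n$ the subgroup $\langle\alpha_p\rangle$ is not contained in $S$. 2. If for every prime $p$ with $p^2\mid n$ the subgroup $\langle\alpha_p\rangle$ is not contained in $S_p$, then $G$ has no non-trivial expansive subgroup with trivial $G$-core. 3. If $G$ has no non-trivial expansive subgroup with trivial $G$-core, then $G$ is a Roquette group. -/

import Mathlib

/-- A (finite) group is a Roquette group if all its normal abelian subgroups are cyclic. -/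
def IsRoquette (G : Type*) [Group G] : Prop :=
  ∀ A : Subgroup G, A.Normal → (∀ x ∈ A, ∀ y ∈ A, x * y = y * x) → IsCyclic A

/-- For subgroups `H ≤ N` of `G`, the `N`-core of `H`: the largest subgroup of `H` that is
normal in `N` (it is a normal subgroup of `N`, here seen in `G`). -/
def coreIn {G : Type*} [Group G] (N H : Subgroup G) : Subgroup G :=
  ((H.subgroupOf N).normalCore).map N.subtype

/-- `T` is expansive in `G` if, for every `g ∉ N_G(T)`, the `N_G(T)`-core of
`(ᵍT ∩ N_G(T)) T` properly contains `T`. As `T` is normal in `N_G(T)`, the product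
`(ᵍT ∩ N_G(T)) T` is the subgroup generated by the two factors. -/
def IsExpansive {G : Type*} [Group G] (T : Subgroup G) : Prop :=
  ∀ g : G, g ∉ Subgroup.normalizer (T : Set G) →
    T < coreIn (Subgroup.normalizer (T : Set G))
      ((T.map (MulAut.conj g).toMonoidHom ⊓ Subgroup.normalizer (T : Set G)) ⊔ T)

namespace CyclicExt

variable (C : Type*)

/-- Write `|C| = p ^ k * m` with `p ∤ m`. This exponent `m ^ φ(p ^ k)` is congruent to `1`
modulo `p ^ k` and to `0` modulo `m`. -/
noncomputable def pExp (p : ℕ) : ℕ :=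
  (Nat.card C / p ^ (Nat.card C).factorization p) ^
    Nat.totient (p ^ (Nat.card C).factorization p)

theorem dvd_pExp {p : ℕ} (hp : p.Prime) :
    Nat.card C / p ^ (Nat.card C).factorization p ∣ pExp C p :=
  dvd_pow_self _ (Nat.totient_pos.2 (pow_pos hp.pos _)).ne'

variable [CommGroup C]

/-- The projection of the finite abelian group `C` onto its `p`-primary part
(see `pPart_of_pow_eq_one` and `pPart_of_coprime`). -/
noncomputable def pPart (p : ℕ) : C →* C := powMonoidHom (pExp C p)

variable {C}

theorem pPart_apply (p : ℕ) (x : C) : pPart C p x = x ^ pExp C p := rfl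

theorem pPart_map (p : ℕ) (σ : MulAut C) (x : C) :
    pPart C p (σ x) = σ (pPart C p x) := by
  simp [pPart_apply]

variable [Finite C]

theorem pExp_modEq_one {p : ℕ} (hp : p.Prime) :
    pExp C p ≡ 1 [MOD p ^ (Nat.card C).factorization p] :=
  Nat.ModEq.pow_totient (Nat.Coprime.pow_right _
    (Nat.coprime_ordCompl hp Nat.card_pos.ne').symm)

theorem pPart_of_pow_eq_one {p : ℕ} (hp : p.Prime) {x : C}
    (hx : x ^ p ^ (Nat.card C).factorization p = 1) : pPart C p x = x := by
  have h := (pow_eq_pow_iff_modEq (x := x) (n := pExp C p) (m := 1)).2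
    ((pExp_modEq_one hp).of_dvd (orderOf_dvd_of_pow_eq_one hx))
  simpa [pPart_apply] using h

theorem pPart_pow {p : ℕ} (hp : p.Prime) (x : C) :
    (pPart C p x) ^ p ^ (Nat.card C).factorization p = 1 := by
  obtain ⟨c, hc⟩ := dvd_pExp C hp
  rw [pPart_apply, ← pow_mul, hc, mul_right_comm,
    Nat.div_mul_cancel (Nat.ordProj_dvd _ _), pow_mul, pow_card_eq_one', one_pow]

theorem pPart_of_coprime {p : ℕ} (hp : p.Prime) {x : C}
    (hx : (orderOf x).Coprime p) : pPart C p x = 1 := by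
  have h : orderOf x ∣ Nat.card C / p ^ (Nat.card C).factorization p := by
    refine (hx.pow_right ((Nat.card C).factorization p)).dvd_of_dvd_mul_left ?_
    rw [Nat.mul_div_cancel' (Nat.ordProj_dvd _ _)]
    exact orderOf_dvd_natCard x
  exact orderOf_dvd_iff_pow_eq_one.1 (h.trans (dvd_pExp C hp))

theorem pPart_pPart {p : ℕ} (hp : p.Prime) (x : C) :
    pPart C p (pPart C p x) = pPart C p x :=
  pPart_of_pow_eq_one hp (pPart_pow hp x)

theorem pPart_projFun {p : ℕ} (hp : p.Prime) (σ : MulAut C) (x : C) :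
    pPart C p (σ (pPart C p x) * (pPart C p x)⁻¹ * x) = σ (pPart C p x) := by
  simp [pPart_map, pPart_pPart hp]

/-- The projection of `Aut(C) = ∏ Aut(C_q)`, with `C_q` the `q`-primary part of `C`, onto the
factor `Aut(C_p)`, which is regarded as a subgroup of `Aut(C)`: the image of `σ` acts as `σ` on
the `p`-primary part and as the identity on the other primary parts
(see `proj_of_pow_eq_one` and `proj_of_coprime`). -/
noncomputable def proj {p : ℕ} (hp : p.Prime) : MulAut C →* MulAut C where
  toFun σ :=
    { toFun := fun x => σ (pPart C p x) * (pPart C p x)⁻¹ * x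
      invFun := fun x => σ⁻¹ (pPart C p x) * (pPart C p x)⁻¹ * x
      left_inv := fun x => by
        change σ⁻¹ (pPart C p (σ (pPart C p x) * (pPart C p x)⁻¹ * x)) *
          (pPart C p (σ (pPart C p x) * (pPart C p x)⁻¹ * x))⁻¹ * _ = x
        rw [pPart_projFun hp]
        simp [mul_assoc]
      right_inv := fun x => by
        change σ (pPart C p (σ⁻¹ (pPart C p x) * (pPart C p x)⁻¹ * x)) *
          (pPart C p (σ⁻¹ (pPart C p x) * (pPart C p x)⁻¹ * x))⁻¹ * _ = x
        rw [pPart_projFun hp]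
        simp [mul_assoc]
      map_mul' := fun x y => by
        simp only [map_mul, mul_inv_rev]
        simp only [mul_comm, mul_left_comm, mul_assoc] }
  map_one' := by
    ext x
    change pPart C p x * (pPart C p x)⁻¹ * x = x
    simp
  map_mul' σ τ := by
    ext x
    change σ (τ (pPart C p x)) * (pPart C p x)⁻¹ * x =
      σ (pPart C p (τ (pPart C p x) * (pPart C p x)⁻¹ * x)) *
        (pPart C p (τ (pPart C p x) * (pPart C p x)⁻¹ * x))⁻¹ * _
    rw [pPart_projFun hp]
    change _ = _ * _ * (τ (pPart C p x) * (pPart C p x)⁻¹ * x)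
    group

theorem proj_apply {p : ℕ} (hp : p.Prime) (σ : MulAut C) (x : C) :
    proj hp σ x = σ (pPart C p x) * (pPart C p x)⁻¹ * x := rfl

theorem proj_of_pow_eq_one {p : ℕ} (hp : p.Prime) (σ : MulAut C) {x : C}
    (hx : x ^ p ^ (Nat.card C).factorization p = 1) : proj hp σ x = σ x := by
  simp [proj_apply, pPart_of_pow_eq_one hp hx]

theorem proj_of_coprime {p : ℕ} (hp : p.Prime) (σ : MulAut C) {x : C}
    (hx : (orderOf x).Coprime p) : proj hp σ x = x := by
  simp [proj_apply, pPart_of_coprime hp hx]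

theorem pPart_pow_pow {p : ℕ} (hp : p.Prime) (h : p ^ 2 ∣ Nat.card C) (x : C) :
    (pPart C p x) ^ (p ^ ((Nat.card C).factorization p - 1) *
      p ^ ((Nat.card C).factorization p - 1)) = 1 := by
  have hk : 2 ≤ (Nat.card C).factorization p :=
    (hp.pow_dvd_iff_le_factorization Nat.card_pos.ne').1 h
  apply orderOf_dvd_iff_pow_eq_one.1
  refine (orderOf_dvd_of_pow_eq_one (pPart_pow hp x)).trans ?_
  rw [← pow_add]
  exact pow_dvd_pow _ (by omega)

/-- The automorphism `α_p` of `C`, where `p ^ k` with `k ≥ 2` is the exact power of `p` dividing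
`|C|`: it sends each element `x` of the `p`-primary part of `C` (in particular, if `C` is cyclic,
a generator of it) to `x ^ (1 + p ^ (k - 1))`, and fixes the other primary parts
(see `alpha_of_pow_eq_one` and `alpha_of_coprime`). -/
noncomputable def alpha {p : ℕ} (hp : p.Prime) (h : p ^ 2 ∣ Nat.card C) : MulAut C where
  toFun x := x * (pPart C p x) ^ p ^ ((Nat.card C).factorization p - 1)
  invFun x := x * ((pPart C p x) ^ p ^ ((Nat.card C).factorization p - 1))⁻¹
  left_inv x := by
    simp only [map_mul, map_pow, pPart_pPart hp, mul_pow, ← pow_mul, pPart_pow_pow hp h]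
    simp
  right_inv x := by
    simp only [map_mul, map_pow, map_inv, pPart_pPart hp, mul_pow, inv_pow, ← pow_mul,
      pPart_pow_pow hp h]
    simp
  map_mul' x y := by
    simp only [map_mul, mul_pow]
    simp only [mul_comm, mul_left_comm, mul_assoc]

theorem alpha_apply {p : ℕ} (hp : p.Prime) (h : p ^ 2 ∣ Nat.card C) (x : C) :
    alpha hp h x = x * (pPart C p x) ^ p ^ ((Nat.card C).factorization p - 1) := rfl

theorem alpha_of_pow_eq_one {p : ℕ} (hp : p.Prime) (h : p ^ 2 ∣ Nat.card C) {x : C}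
    (hx : x ^ p ^ (Nat.card C).factorization p = 1) :
    alpha hp h x = x ^ (1 + p ^ ((Nat.card C).factorization p - 1)) := by
  rw [alpha_apply, pPart_of_pow_eq_one hp hx, pow_add, pow_one]

theorem alpha_of_coprime {p : ℕ} (hp : p.Prime) (h : p ^ 2 ∣ Nat.card C) {x : C}
    (hx : (orderOf x).Coprime p) : alpha hp h x = x := by
  rw [alpha_apply, pPart_of_coprime hp hx, one_pow, mul_one]

end CyclicExt

/-!
Write `n = |C|`, and identify `C` with its image in `G`, which is normal and its own centralizer.
Both the Roquette property and the existence of expansive subgroups come down to automorphisms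
`σ` of `C` with `(σ - 1) ^ 2 = 0` in the endomorphism ring `ℤ/n` of `C`. For these,
`σ ^ m = 1 + m (σ - 1)`, so if `σ ≠ 1`, every prime `p` dividing the order of `σ - 1` satisfies
`p ^ 2 ∣ n` and `α_p ∈ ⟨σ⟩` (`alpha_mem_zpowers_of_unipotent`).

* If `G` is not a Roquette group, a noncyclic abelian normal subgroup `A` contains an element
  outside `C`. It acts on `C` as such a `σ ≠ 1`, since `A` centralizes `[A, C] ≤ A`. So some `α_p`
  lies in `S` (`exists_alpha_mem_of_not_isRoquette`).
* If `α_p ∈ S`, then `α_p` lifts to an element `b` of order `p` of `G` whose conjugates lie in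
  `Z b`, with `Z` the subgroup of order `p` of `C` (`exists_lift_of_alpha_mem`). This depends on the
  norm map `1 + α_p + ⋯ + α_p ^ (p - 1)` of `C` having the same kernel as multiplication by `p`, and
  its image containing the fixed points of `α_p`. Here the exponent of `2` in `n` has to be different
  from `2`. Then `Z × ⟨b⟩` is a noncyclic abelian normal subgroup, so `G` is not a Roquette group
  (`not_isRoquette_of_alpha_mem`), and `⟨b⟩` is expansive with trivial core
  (`exists_isExpansive_of_alpha_mem`).
* Let `T ≠ 1` have trivial core. Then `T ∩ C = 1`, as all subgroups of `C` are normal in `G`. So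
  `T` acts nontrivially on the `p`-primary part of `C` for some `p`, and `N_G(T) ∩ C` consists of
  the fixed points of `T` in `C`. If `c` generates this `p`-primary part and `t ∈ T` is such that
  `c t c⁻¹ ∈ N_G(T)`, then `(t - 1) c` is fixed by `T`, so `(t - 1) ^ 2 = 0` on the `p`-primary
  part. If `α_p ∉ S_p`, this forces `t` to centralize `c`. So `c` conjugates `T` to a group which
  meets `N_G(T)` in a subgroup of `T`, and `T` is not expansive (`eq_bot_of_isExpansive`).
-/

/-! ### Cyclic groups and cores -/

/-- In a cyclic group, a nontrivial element of exponent a prime `p` generates all elements of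
exponent `p`. -/
theorem mem_zpowers_of_pow_prime_eq_one {H : Type*} [Group H] [IsCyclic H] {p : ℕ}
    (hp : p.Prime) {x y : H} (hx : x ^ p = 1) (hy : y ^ p = 1) (hy1 : y ≠ 1) :
    x ∈ Subgroup.zpowers y := by
  obtain ⟨w, hw⟩ := IsCyclic.exists_generator (α := H)
  obtain ⟨i, rfl⟩ := hw x
  obtain ⟨j, rfl⟩ := hw y
  simp only [← zpow_natCast, ← zpow_mul] at hx hy
  rw [← orderOf_dvd_iff_zpow_eq_one] at hx hy
  rw [Ne, ← orderOf_dvd_iff_zpow_eq_one] at hy1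
  have hpo : p ∣ orderOf w := by
    by_contra h
    have hc : IsCoprime (orderOf w : ℤ) p :=
      Nat.isCoprime_iff_coprime.2 ((hp.coprime_iff_not_dvd.2 h).symm)
    exact hy1 (hc.dvd_of_dvd_mul_right hy)
  obtain ⟨q, hq⟩ := hpo
  have hp0 : (p : ℤ) ≠ 0 := by exact_mod_cast hp.ne_zero
  rw [hq] at hx hy hy1
  push_cast at hx hy hy1
  rw [mul_comm] at hx hy
  obtain ⟨i', rfl⟩ := Int.dvd_of_mul_dvd_mul_right hp0 hx
  obtain ⟨j', rfl⟩ := Int.dvd_of_mul_dvd_mul_right hp0 hy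
  have hj : IsCoprime (p : ℤ) j' := by
    refine (Nat.prime_iff_prime_int.1 hp).irreducible.coprime_iff_not_dvd.2 fun h => hy1 ?_
    rw [mul_comm (p : ℤ)]
    exact mul_dvd_mul_left _ h
  -- Now `x = w ^ (q * i')` and `y = w ^ (q * j')` with `j'` invertible modulo `p`.
  obtain ⟨a, b, hab⟩ := hj
  have hw1 : w ^ ((p : ℤ) * q) = 1 := by
    rw [← Nat.cast_mul, ← hq, zpow_natCast, pow_orderOf_eq_one]
  refine ⟨i' * b, ?_⟩
  change (w ^ _) ^ _ = _
  have h : (q : ℤ) * i' = (p : ℤ) * q * (i' * a) + q * j' * (i' * b) := by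
    linear_combination (-(q : ℤ) * i') * hab
  change _ = w ^ _
  rw [h, zpow_add, zpow_mul w ((p : ℤ) * q), hw1, one_zpow, one_mul, zpow_mul w (q * j')]

theorem mem_coreIn_of_forall_conj_mem {G : Type*} [Group G] {N H : Subgroup G} {x : G}
    (hx : x ∈ N) (h : ∀ n ∈ N, n * x * n⁻¹ ∈ H) : x ∈ coreIn N H :=
  ⟨⟨x, hx⟩, fun n => h n n.2, rfl⟩

theorem coreIn_le {G : Type*} [Group G] (N H : Subgroup G) : coreIn N H ≤ H := by
  rintro _ ⟨y, hy, rfl⟩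
  exact Subgroup.mem_subgroupOf.1 (Subgroup.normalCore_le _ hy)

namespace CyclicExt

/-! ### Unipotent automorphisms of a cyclic group -/

section Aut

variable {C : Type*} [CommGroup C]

/-- If `(σ - 1) ^ 2 = 0` in additive notation, then `σ ^ m = 1 + m (σ - 1)`. -/
theorem pow_apply_of_unipotent {σ : MulAut C} (hσ : ∀ x, σ (σ x * x⁻¹) = σ x * x⁻¹)
    (m : ℕ) (x : C) : (σ ^ m) x = x * (σ x * x⁻¹) ^ m := by
  induction m with
  | zero => simp
  | succ m ih =>
    rw [pow_succ', MulAut.mul_apply, ih, map_mul, map_pow, hσ, pow_succ']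
    rw [← mul_assoc, ← mul_assoc, mul_comm x, mul_inv_cancel_right]

theorem mulAut_ext_of_generator {g : C} (hg : ∀ x, x ∈ Subgroup.zpowers g) {σ τ : MulAut C}
    (h : σ g = τ g) : σ = τ := by
  ext x
  obtain ⟨i, rfl⟩ := hg x
  simp only [map_zpow, h]

theorem mulAut_mul_comm [IsCyclic C] (σ τ : MulAut C) : σ * τ = τ * σ := by
  obtain ⟨m, hm⟩ := MonoidHom.map_cyclic σ.toMonoidHom
  ext x
  have hm' : ∀ y, σ y = y ^ m := hm
  simp [hm']

/-- The endomorphism `α_p - 1` of `C` (in additive notation). It is defined for all `p`, but has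
this meaning only if `p ^ 2 ∣ |C|`. -/
noncomputable def eps (C : Type*) [CommGroup C] (p : ℕ) : C →* C :=
  (powMonoidHom (p ^ ((Nat.card C).factorization p - 1))).comp (pPart C p)

theorem eps_apply (p : ℕ) (x : C) :
    eps C p x = (pPart C p x) ^ p ^ ((Nat.card C).factorization p - 1) := rfl

theorem eps_of_pow_eq_one {p m : ℕ} {x : C} (hx : x ^ p ^ m = 1)
    (hm : m ≤ (Nat.card C).factorization p - 1) : eps C p x = 1 := by
  rw [eps_apply, ← map_pow, ← Nat.add_sub_cancel' hm, pow_add, pow_mul, hx, one_pow, map_one]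

variable [Finite C]

theorem pPart_ne_one_of_dvd_orderOf {p : ℕ} (hp : p.Prime) {x : C} (hx : p ∣ orderOf x) :
    pPart C p x ≠ 1 := by
  intro h
  rw [pPart_apply, ← orderOf_dvd_iff_pow_eq_one] at h
  have hk : (Nat.card C).factorization p ≠ 0 :=
    (hp.factorization_pos_of_dvd Nat.card_pos.ne' (hx.trans (orderOf_dvd_natCard x))).ne'
  have h1 := (pExp_modEq_one (C := C) hp).of_dvd (dvd_pow_self p hk)
  have h0 : pExp C p ≡ 0 [MOD p] := (Nat.modEq_zero_iff_dvd).2 (hx.trans h)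
  exact hp.one_lt.ne' (Nat.dvd_one.1 ((Nat.modEq_zero_iff_dvd).1 (h1.symm.trans h0)))

theorem alpha_apply_eq_mul_eps {p : ℕ} (hp : p.Prime) (h : p ^ 2 ∣ Nat.card C) (x : C) :
    alpha hp h x = x * eps C p x := rfl

theorem two_le_factorization {p : ℕ} (hp : p.Prime) (h : p ^ 2 ∣ Nat.card C) :
    2 ≤ (Nat.card C).factorization p :=
  (hp.pow_dvd_iff_le_factorization Nat.card_pos.ne').1 h

theorem eps_pow {p : ℕ} (hp : p.Prime) (h : p ^ 2 ∣ Nat.card C) (x : C) :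
    eps C p x ^ p = 1 := by
  have hk := two_le_factorization hp h
  rw [eps_apply, ← pow_mul, ← pow_succ, Nat.sub_add_cancel (by omega), pPart_pow hp]

theorem eps_of_pow_prime_eq_one {p : ℕ} (hp : p.Prime) (h : p ^ 2 ∣ Nat.card C) {x : C}
    (hx : x ^ p = 1) : eps C p x = 1 := by
  have hk := two_le_factorization hp h
  exact eps_of_pow_eq_one (m := 1) (by simpa using hx) (by omega)

theorem alpha_of_pow_prime_eq_one {p : ℕ} (hp : p.Prime) (h : p ^ 2 ∣ Nat.card C) {x : C}
    (hx : x ^ p = 1) : alpha hp h x = x := by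
  rw [alpha_apply_eq_mul_eps, eps_of_pow_prime_eq_one hp h hx, mul_one]

theorem alpha_unipotent {p : ℕ} (hp : p.Prime) (h : p ^ 2 ∣ Nat.card C) (x : C) :
    alpha hp h (alpha hp h x * x⁻¹) = alpha hp h x * x⁻¹ := by
  rw [alpha_apply_eq_mul_eps hp h x, mul_inv_cancel_comm]
  exact alpha_of_pow_prime_eq_one hp h (eps_pow hp h x)

theorem alpha_pow_apply {p : ℕ} (hp : p.Prime) (h : p ^ 2 ∣ Nat.card C) (m : ℕ) (x : C) :
    (alpha hp h ^ m) x = x * eps C p x ^ m := by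
  rw [pow_apply_of_unipotent (alpha_unipotent hp h), alpha_apply_eq_mul_eps,
    mul_inv_cancel_comm]

theorem alpha_pow_prime {p : ℕ} (hp : p.Prime) (h : p ^ 2 ∣ Nat.card C) :
    alpha hp h ^ p = 1 := by
  ext x
  rw [alpha_pow_apply, eps_pow hp h, mul_one, MulAut.one_apply]

theorem orderOf_eps_generator {p : ℕ} (hp : p.Prime) (h : p ^ 2 ∣ Nat.card C) {g : C}
    (hg : ∀ x, x ∈ Subgroup.zpowers g) : orderOf (eps C p g) = p := by
  have := Fact.mk hp
  refine orderOf_eq_prime (eps_pow hp h g) ?_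
  have hk := two_le_factorization hp h
  rw [eps_apply, ← map_pow]
  refine pPart_ne_one_of_dvd_orderOf hp ?_
  have ho : orderOf g = Nat.card C := orderOf_eq_card_of_forall_mem_zpowers hg
  have hd : p ^ (Nat.card C).factorization p ∣ orderOf g := ho ▸ Nat.ordProj_dvd _ _
  obtain ⟨m, hm⟩ := hd
  have hk1 : (Nat.card C).factorization p = (Nat.card C).factorization p - 1 + 1 := by omega
  have hm' : orderOf g = p ^ ((Nat.card C).factorization p - 1) * (p * m) := by
    rw [← mul_assoc, ← pow_succ, ← hk1, hm]
  rw [orderOf_pow_of_dvd (pow_pos hp.pos _).ne' ⟨_, hm'⟩, hm',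
    Nat.mul_div_cancel_left _ (pow_pos hp.pos _)]
  exact dvd_mul_right _ _

/-- Let `σ` act on `C ≅ ℤ/n` as multiplication by `r`. If `(r - 1) ^ 2 = 0`, then
`r ^ m = 1 + m (r - 1)`, so the powers of `r` are the elements of `1 + R`, where `R` is the additive
subgroup generated by `r - 1`. If `p` divides the order of `R`, then `R` contains every residue of
additive order `p`, among them the one by which `α_p - 1` acts. -/
theorem alpha_mem_zpowers_of_unipotent [IsCyclic C] {g : C} (hg : ∀ x, x ∈ Subgroup.zpowers g)
    {σ : MulAut C} (hσ : ∀ x, σ (σ x * x⁻¹) = σ x * x⁻¹) {p : ℕ} (hp : p.Prime)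
    (hpo : p ∣ orderOf (σ g * g⁻¹)) :
    ∃ h : p ^ 2 ∣ Nat.card C, alpha hp h ∈ Subgroup.zpowers σ := by
  obtain ⟨q, hq⟩ := hpo
  have ho0 : 0 < orderOf (σ g * g⁻¹) := orderOf_pos _
  have hq0 : 0 < q := Nat.pos_of_ne_zero fun h0 => by simp [hq, h0] at ho0
  have hyp : ((σ g * g⁻¹) ^ q) ^ p = 1 := by
    rw [← pow_mul, mul_comm q, ← hq, pow_orderOf_eq_one]
  have hy1 : (σ g * g⁻¹) ^ q ≠ 1 := by
    intro h1
    have := Nat.le_of_dvd hq0 (orderOf_dvd_of_pow_eq_one h1)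
    rw [hq] at this
    nlinarith [hp.two_le]
  have hmem : ∀ x : C, x ^ p = 1 → ∃ m : ℕ, x = (σ g * g⁻¹) ^ m := by
    intro x hx
    have h1 := mem_zpowers_of_pow_prime_eq_one hp hx hyp hy1
    obtain ⟨m, hm⟩ := mem_powers_iff_mem_zpowers.2 h1
    exact ⟨q * m, by rw [pow_mul]; exact hm.symm⟩
  have hh : p ^ 2 ∣ Nat.card C := by
    obtain ⟨c, hc⟩ : p ∣ Nat.card C :=
      (Dvd.intro q hq.symm).trans (orderOf_dvd_natCard (σ g * g⁻¹))
    have h1 : (g ^ c) ^ p = 1 := by rw [← pow_mul, mul_comm c, ← hc, pow_card_eq_one']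
    obtain ⟨m, hm⟩ := hmem _ h1
    -- `σ - 1` kills `g ^ c`, which lies in its image, so the order of `(σ - 1) g` divides `c`.
    have h2 : σ (g ^ c) = g ^ c := by rw [hm, map_pow, hσ]
    have h3 : (σ g * g⁻¹) ^ c = 1 := by
      rw [mul_pow, ← map_pow, h2, inv_pow, mul_inv_cancel]
    have h4 : p ∣ c := (Dvd.intro q hq.symm).trans (orderOf_dvd_of_pow_eq_one h3)
    rw [hc, pow_two]
    exact mul_dvd_mul_left p h4
  refine ⟨hh, ?_⟩
  obtain ⟨m, hm⟩ := hmem _ (eps_pow hp hh g)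
  rw [show alpha hp hh = σ ^ m from mulAut_ext_of_generator hg (by
    rw [alpha_apply_eq_mul_eps, hm, pow_apply_of_unipotent hσ])]
  exact pow_mem (Subgroup.mem_zpowers σ) m

end Aut

/-! ### The norm map of `α_p` -/

section Norm

variable {C G : Type*} [CommGroup C] [Finite C] [Group G]

/-- For `m = p` the first factor is the image of the norm `c · α_p(c) ⋯ α_p ^ (p - 1) (c)`. -/
theorem ι_mul_pow {ι : C →* G} {p : ℕ} (hp : p.Prime)
    (h : p ^ 2 ∣ Nat.card C) {a : G} (ha : ∀ c, a * ι c * a⁻¹ = ι (alpha hp h c)) (c : C) (m : ℕ) :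
    (ι c * a) ^ m = ι (c ^ m * eps C p c ^ m.choose 2) * a ^ m := by
  have hpow : ∀ i : ℕ, ∀ x, a ^ i * ι x * (a ^ i)⁻¹ = ι ((alpha hp h ^ i) x) := by
    intro i
    induction i with
    | zero => simp
    | succ i ih =>
      intro x
      rw [pow_succ a, pow_succ (alpha hp h), MulAut.mul_apply, ← ih, ← ha]
      group
  induction m with
  | zero => simp
  | succ m ih =>
    have h1 : a ^ m * ι c = ι (c * eps C p c ^ m) * a ^ m := by
      rw [← alpha_pow_apply hp h, ← hpow, inv_mul_cancel_right]
    rw [pow_succ (ι c * a), ih, mul_assoc, ← mul_assoc (a ^ m), h1, mul_assoc, ← pow_succ,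
      ← mul_assoc, ← map_mul, Nat.choose_succ_succ' m 1, Nat.choose_one_right]
    congr 2
    rw [pow_succ, pow_add]
    simp only [one_add_one_eq_two, mul_comm, mul_left_comm, mul_assoc]

/-- The norm map `c ↦ c · α_p(c) ⋯ α_p ^ (p - 1) (c)` has the kernel of `c ↦ c ^ p`. This fails for
`p = 2` and `k = 2`, where `α_p` is the inversion on the `2`-primary part. -/
theorem pow_prime_eq_one_of_norm_eq_one {p : ℕ} (hp : p.Prime) (h : p ^ 2 ∣ Nat.card C)
    (h2 : p = 2 → (Nat.card C).factorization p ≠ 2) {c : C}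
    (hc : c ^ p * eps C p c ^ p.choose 2 = 1) : c ^ p = 1 := by
  rcases hp.eq_two_or_odd' with rfl | hodd
  · have hk := two_le_factorization hp h
    have hk2 := h2 rfl
    have h4 : c ^ 2 ^ 2 = 1 := by
      have h3 : c ^ 2 = (eps C 2 c)⁻¹ := by simpa [mul_eq_one_iff_eq_inv] using hc
      rw [pow_two 2, pow_mul, h3, inv_pow, eps_pow hp h, inv_one]
    have h5 : eps C 2 c = 1 := eps_of_pow_eq_one h4 (by omega)
    simpa [h5] using hc
  · obtain ⟨j, hj⟩ := hodd
    have : p.choose 2 = p * j := by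
      rw [Nat.choose_two_right, show p - 1 = 2 * j by omega, mul_left_comm,
        Nat.mul_div_cancel_left _ two_pos]
    rwa [this, pow_mul, eps_pow hp h, one_pow, mul_one] at hc

/-- The image of the norm map `c ↦ c · α_p(c) ⋯ α_p ^ (p - 1) (c)` contains the fixed points of
`α_p`. -/
theorem exists_norm_eq {p : ℕ} (hp : p.Prime) (h : p ^ 2 ∣ Nat.card C)
    (h2 : p = 2 → (Nat.card C).factorization p ≠ 2) {g : C}
    (hg : ∀ x, x ∈ Subgroup.zpowers g) {d : C} (hd : eps C p d = 1) :
    ∃ c, c ^ p * eps C p c ^ p.choose 2 = d := by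
  obtain ⟨e, rfl⟩ : ∃ e, e ^ p = d := by
    obtain ⟨j, rfl⟩ := hg d
    rw [map_zpow, ← orderOf_dvd_iff_zpow_eq_one, orderOf_eps_generator hp h hg] at hd
    obtain ⟨i, rfl⟩ := hd
    exact ⟨g ^ i, by rw [← zpow_natCast, ← zpow_mul, mul_comm]⟩
  rcases hp.eq_two_or_odd' with rfl | hodd
  · have hk := two_le_factorization hp h
    have hk2 := h2 rfl
    -- As `k ≥ 3`, the element `(α - 1) e` has a square root which is fixed by `α`.
    set k := (Nat.card C).factorization 2
    obtain ⟨f, hf⟩ : ∃ f, f = pPart C 2 e ^ 2 ^ (k - 2) := ⟨_, rfl⟩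
    have hf2 : f ^ 2 = eps C 2 e := by
      rw [hf, eps_apply, ← pow_mul, ← pow_succ, show k - 2 + 1 = k - 1 by omega]
    have hf4 : f ^ 2 ^ 2 = 1 := by rw [pow_two 2, pow_mul, hf2, eps_pow hp h]
    have hfe : eps C 2 f = 1 := eps_of_pow_eq_one hf4 (by omega)
    refine ⟨e * f, ?_⟩
    have he : eps C 2 e * eps C 2 e = 1 := by rw [← pow_two, eps_pow hp h]
    simp [hfe, mul_pow, hf2, mul_assoc, he]
  · obtain ⟨j, hj⟩ := hodd
    have : p.choose 2 = p * j := by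
      rw [Nat.choose_two_right, show p - 1 = 2 * j by omega, mul_left_comm,
        Nat.mul_div_cancel_left _ two_pos]
    exact ⟨e, by rw [this, pow_mul, eps_pow hp h, one_pow, mul_one]⟩

end Norm

/-! ### Groups with a self-centralizing cyclic normal subgroup -/

section Extension

variable {C G : Type*} [CommGroup C] [Group G]
  {S : Subgroup (MulAut C)} {ι : C →* G} {π : G →* S}

theorem exists_ι_eq_of_coe_eq_one (hexact : ι.range = π.ker) {x : G}
    (hx : (π x : MulAut C) = 1) : ∃ c, ι c = x := by
  have : x ∈ ι.range := by
    rw [hexact, MonoidHom.mem_ker]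
    exact Subtype.ext hx
  exact this

variable [IsCyclic C]

theorem conj_ι_mem {T : Subgroup G}
    (hconj : ∀ (g : G) (c : C), ι ((π g : MulAut C) c) = g * ι c * g⁻¹) {c : C}
    (hc : ι c ∈ T) (g : G) : g * ι c * g⁻¹ ∈ T := by
  obtain ⟨m, hm⟩ := MonoidHom.map_cyclic (π g : MulAut C).toMonoidHom
  have hm' : (π g : MulAut C) c = c ^ m := hm c
  rw [← hconj, hm', map_zpow]
  exact zpow_mem hc m

variable [Finite C]

/-- If `α_p ∈ S`, then some preimage `b` of `α_p` in `G` has order `p`, and all conjugates of `b`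
lie in the coset of `b` modulo the subgroup of order `p` of `C`. -/
theorem exists_lift_of_alpha_mem (hι : Function.Injective ι) (hπ : Function.Surjective π)
    (hexact : ι.range = π.ker)
    (hconj : ∀ (g : G) (c : C), ι ((π g : MulAut C) c) = g * ι c * g⁻¹)
    {p : ℕ} (hp : p.Prime) (h : p ^ 2 ∣ Nat.card C)
    (h2 : p = 2 → (Nat.card C).factorization p ≠ 2) (hS : alpha hp h ∈ S) :
    ∃ b : G, (π b : MulAut C) = alpha hp h ∧ b ^ p = 1 ∧
      ∀ g, ∃ c, c ^ p = 1 ∧ g * b * g⁻¹ = ι c * b := by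
  obtain ⟨w, hw⟩ := IsCyclic.exists_generator (α := C)
  obtain ⟨a, ha⟩ := hπ ⟨_, hS⟩
  have ha' : (π a : MulAut C) = alpha hp h := congrArg Subtype.val ha
  have hconja : ∀ b : G, (π b : MulAut C) = alpha hp h →
      ∀ c, b * ι c * b⁻¹ = ι (alpha hp h c) := fun b hb c => by rw [← hconj, hb]
  obtain ⟨d, hd⟩ := exists_ι_eq_of_coe_eq_one (x := a ^ p) hexact (by
    rw [map_pow, Subgroup.coe_pow, ha', alpha_pow_prime])
  have hde : eps C p d = 1 := by
    have h1 : alpha hp h d = d := hι (by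
      rw [← hconja a ha', hd, ← pow_succ', pow_succ, mul_inv_cancel_right])
    rwa [alpha_apply_eq_mul_eps, mul_eq_left] at h1
  obtain ⟨c, hc⟩ := exists_norm_eq hp h h2 hw (d := d⁻¹) (by rw [map_inv, hde, inv_one])
  have hker : ∀ x, (π (ι x) : MulAut C) = 1 := fun x => by
    have : ι x ∈ π.ker := hexact ▸ ⟨x, rfl⟩
    rw [MonoidHom.mem_ker.1 this, Subgroup.coe_one]
  have hb : (π (ι c * a) : MulAut C) = alpha hp h := by
    rw [map_mul, Subgroup.coe_mul, hker, one_mul, ha']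
  have hbp : (ι c * a) ^ p = 1 := by
    rw [ι_mul_pow hp h (hconja a ha'), hc, ← hd, ← map_mul, inv_mul_cancel, map_one]
  refine ⟨ι c * a, hb, hbp, fun g => ?_⟩
  generalize ι c * a = b at hb hbp
  obtain ⟨e, he⟩ := exists_ι_eq_of_coe_eq_one (x := g * b * g⁻¹ * b⁻¹) hexact (by
    simp only [map_mul, map_inv, Subgroup.coe_mul, Subgroup.coe_inv]
    rw [mulAut_mul_comm (π g : MulAut C), mul_inv_cancel_right, mul_inv_cancel])
  have he' : g * b * g⁻¹ = ι e * b := by rw [he, inv_mul_cancel_right]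
  refine ⟨e, pow_prime_eq_one_of_norm_eq_one hp h h2 (hι ?_), he'⟩
  rw [map_one, ← mul_one (ι _), ← hbp, ← ι_mul_pow hp h (hconja b hb), ← he', conj_pow, hbp]
  simp

/-- With `b` as in `exists_lift_of_alpha_mem` and `Z` the subgroup of order `p` of `C`, the subgroup
`Z × ⟨b⟩` is normal and elementary abelian of rank two. -/
theorem not_isRoquette_of_alpha_mem (hι : Function.Injective ι) (hπ : Function.Surjective π)
    (hexact : ι.range = π.ker)
    (hconj : ∀ (g : G) (c : C), ι ((π g : MulAut C) c) = g * ι c * g⁻¹)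
    {p : ℕ} (hp : p.Prime) (h : p ^ 2 ∣ Nat.card C)
    (h2 : p = 2 → (Nat.card C).factorization p ≠ 2) (hS : alpha hp h ∈ S) :
    ¬ IsRoquette G := by
  intro hR
  obtain ⟨w, hw⟩ := IsCyclic.exists_generator (α := C)
  obtain ⟨b, hb, hbp, hbc⟩ := exists_lift_of_alpha_mem hι hπ hexact hconj hp h h2 hS
  have hcomm : ∀ c, c ^ p = 1 → b * ι c = ι c * b := fun c hc => by
    rw [← mul_inv_eq_iff_eq_mul, ← hconj, hb, alpha_of_pow_prime_eq_one hp h hc]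
  set X : Set G := insert b (ι '' {c | c ^ p = 1})
  have hιX : ∀ c, c ^ p = 1 → ι c ∈ Subgroup.closure X := fun c hc =>
    Subgroup.subset_closure (Or.inr ⟨c, hc, rfl⟩)
  have hbX : b ∈ Subgroup.closure X := Subgroup.subset_closure (Or.inl rfl)
  have hnormal : (Subgroup.closure X).Normal := by
    refine ⟨fun x hx g => ?_⟩
    induction hx using Subgroup.closure_induction with
    | mem x hx =>
      rcases hx with rfl | ⟨c, hc, rfl⟩
      · obtain ⟨c, hc, hgc⟩ := hbc g
        rw [hgc]
        exact mul_mem (hιX c hc) hbX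
      · exact conj_ι_mem hconj (hιX c hc) g
    | one => simp
    | mul x y _ _ hx hy =>
      rw [← conj_mul]
      exact mul_mem hx hy
    | inv x _ hx =>
      rw [← conj_inv]
      exact inv_mem hx
  have habel := Subgroup.isMulCommutative_closure (k := X) (by
    rintro x (rfl | ⟨c, hc, rfl⟩) y (rfl | ⟨d, hd, rfl⟩)
    · rfl
    · exact hcomm d hd
    · exact (hcomm c hc).symm
    · rw [← map_mul, mul_comm, map_mul])
  -- If the subgroup were cyclic, `b` would be a power of the element `eps C p w` of order `p`.
  have hcyc := hR _ hnormal fun x hx y hy => setLike_mul_comm hx hy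
  have hz : eps C p w ≠ 1 := by
    rw [Ne, ← orderOf_eq_one_iff, orderOf_eps_generator hp h hw]
    exact hp.one_lt.ne'
  have hzp := eps_pow hp h w
  have hmem := mem_zpowers_of_pow_prime_eq_one hp
    (x := (⟨b, hbX⟩ : Subgroup.closure X)) (y := ⟨ι (eps C p w), hιX _ hzp⟩)
    (Subtype.ext hbp) (Subtype.ext (by rw [Subgroup.coe_pow, ← map_pow, hzp]; exact map_one ι))
    (fun h1 => hz (hι ((congrArg Subtype.val h1).trans (map_one ι).symm)))
  obtain ⟨m, hm⟩ := hmem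
  have hm' : ι (eps C p w ^ m) = b := by
    rw [map_zpow]
    exact congrArg Subtype.val hm
  have h1 : b * ι w * b⁻¹ = ι w := by
    rw [← hm', ← map_mul, ← map_inv, ← map_mul, mul_inv_cancel_comm]
  rw [← hconj, hb] at h1
  exact hz (by simpa [alpha_apply_eq_mul_eps] using hι h1)

/-- With `b` as in `exists_lift_of_alpha_mem` and `Z` the subgroup of order `p` of `C`, the subgroup
`⟨b⟩` is expansive: a conjugate of `b` which is not in `⟨b⟩` generates with `b` a group
containing `Z`, and `Z` is normal in `G`. -/
theorem exists_isExpansive_of_alpha_mem (hι : Function.Injective ι)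
    (hπ : Function.Surjective π) (hexact : ι.range = π.ker)
    (hconj : ∀ (g : G) (c : C), ι ((π g : MulAut C) c) = g * ι c * g⁻¹)
    {p : ℕ} (hp : p.Prime) (h : p ^ 2 ∣ Nat.card C)
    (h2 : p = 2 → (Nat.card C).factorization p ≠ 2) (hS : alpha hp h ∈ S) :
    ∃ T : Subgroup G, T.normalCore = ⊥ ∧ IsExpansive T ∧ T ≠ ⊥ := by
  obtain ⟨w, hw⟩ := IsCyclic.exists_generator (α := C)
  obtain ⟨b, hb, hbp, hbc⟩ := exists_lift_of_alpha_mem hι hπ hexact hconj hp h h2 hS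
  have hpowers : ∀ x ∈ Subgroup.zpowers b, ∃ i : ℕ, b ^ i = x := fun x hx => by
    have hfin : IsOfFinOrder b := isOfFinOrder_iff_pow_eq_one.2 ⟨p, hp.pos, hbp⟩
    exact hfin.mem_powers_iff_mem_zpowers.2 hx
  have hpow : ∀ i : ℕ, b ^ i * ι w * (b ^ i)⁻¹ = ι w * ι (eps C p w ^ i) := fun i => by
    rw [← hconj, map_pow, Subgroup.coe_pow, hb, alpha_pow_apply, map_mul]
  have hi1 : ∀ i : ℕ, eps C p w ^ i = 1 → b ^ i = 1 := fun i hi => by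
    rw [← orderOf_dvd_iff_pow_eq_one, orderOf_eps_generator hp h hw] at hi
    obtain ⟨j, rfl⟩ := hi
    rw [pow_mul, hbp, one_pow]
  have htriv : ∀ c, ι c ∈ Subgroup.zpowers b → ι c = 1 := fun c hc => by
    obtain ⟨i, hi⟩ := hpowers _ hc
    have h1 := hpow i
    rw [hi, ← map_inv, ← map_mul, ← map_mul, mul_inv_cancel_comm, ← map_mul] at h1
    have h3 : eps C p w ^ i = 1 := by simpa using (hι h1).symm
    rw [← hi, hi1 i h3]
  refine ⟨Subgroup.zpowers b, ?_, ?_, ?_⟩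
  · rw [eq_bot_iff]
    intro x hx
    obtain ⟨i, rfl⟩ := hpowers x (Subgroup.normalCore_le _ hx)
    -- The commutator of `b ^ i` with a generator of `C` lies in `⟨b⟩ ∩ C = 1`.
    have hmem : (ι w)⁻¹ * b ^ i * ι w * (b ^ i)⁻¹ ∈ Subgroup.zpowers b := by
      have h1 : (ι w)⁻¹ * b ^ i * (ι w)⁻¹⁻¹ ∈ Subgroup.zpowers b := hx (ι w)⁻¹
      rw [inv_inv] at h1
      exact mul_mem h1 (inv_mem (pow_mem (Subgroup.mem_zpowers b) i))
    have h1 : (ι w)⁻¹ * b ^ i * ι w * (b ^ i)⁻¹ = ι (eps C p w ^ i) := by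
      rw [mul_assoc _ (b ^ i), mul_assoc, hpow, inv_mul_cancel_left]
    rw [h1] at hmem
    exact Subgroup.mem_bot.2 (hi1 i (hι ((htriv _ hmem).trans (map_one ι).symm)))
  · intro y hy
    obtain ⟨c, hc, hyc⟩ := hbc y
    set N := Subgroup.normalizer (Subgroup.zpowers b : Set G)
    have hc1 : ι c ≠ 1 := by
      intro h1
      rw [h1, one_mul] at hyc
      refine hy (Subgroup.mem_normalizer_iff_map_conj_eq.2 ?_)
      change (Subgroup.zpowers b).map (MulAut.conj y).toMonoidHom = _
      rw [MonoidHom.map_zpowers]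
      exact congrArg Subgroup.zpowers hyc
    have hTN : Subgroup.zpowers b ≤ N := Subgroup.le_normalizer
    have hcb : b * ι c = ι c * b := by
      rw [← mul_inv_eq_iff_eq_mul, ← hconj, hb, alpha_of_pow_prime_eq_one hp h hc]
    have hcN : ι c ∈ N := by
      refine Subgroup.mem_normalizer_iff_map_conj_eq.2 ?_
      change (Subgroup.zpowers b).map (MulAut.conj (ι c)).toMonoidHom = _
      rw [MonoidHom.map_zpowers]
      refine congrArg Subgroup.zpowers ?_
      change ι c * b * (ι c)⁻¹ = b
      rw [← hcb, mul_inv_cancel_right]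
    set K := (Subgroup.zpowers b).map (MulAut.conj y).toMonoidHom ⊓ N ⊔ Subgroup.zpowers b
    have hTK : Subgroup.zpowers b ≤ K := le_sup_right
    have hcK : ι c ∈ K := by
      have h1 : ι c * b ∈ K := by
        refine le_sup_left (a := _ ⊓ N) ⟨⟨b, Subgroup.mem_zpowers b, hyc⟩, ?_⟩
        exact mul_mem hcN (hTN (Subgroup.mem_zpowers b))
      exact (Subgroup.mul_mem_cancel_right _ (hTK (Subgroup.mem_zpowers b))).1 h1
    have hle : Subgroup.zpowers b ≤ coreIn N K := fun t ht =>
      mem_coreIn_of_forall_conj_mem (hTN ht) fun n hn =>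
        hTK ((Subgroup.mem_normalizer_iff.1 hn t).1 ht)
    have hcore : ι c ∈ coreIn N K :=
      mem_coreIn_of_forall_conj_mem hcN fun n _ => conj_ι_mem hconj hcK n
    exact lt_of_le_of_ne hle fun heq => hc1 (htriv c (heq ▸ hcore))
  · intro h1
    rw [Subgroup.zpowers_eq_bot] at h1
    have h3 := hpow 1
    have h4 : eps C p w = 1 := hι (by simpa [h1] using h3)
    have := orderOf_eps_generator hp h hw
    rw [h4, orderOf_one] at this
    exact hp.one_lt.ne this

/-- A normal abelian subgroup `A` which is not contained in `C` acts on `C` by automorphisms `σ`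
with `(σ - 1) ^ 2 = 0`, because `[A, C] ≤ A` is centralized by `A`. -/
theorem exists_alpha_mem_of_not_isRoquette (hι : Function.Injective ι)
    (hexact : ι.range = π.ker)
    (hconj : ∀ (g : G) (c : C), ι ((π g : MulAut C) c) = g * ι c * g⁻¹)
    (hR : ¬ IsRoquette G) :
    ∃ (p : ℕ) (hp : p.Prime) (h : p ^ 2 ∣ Nat.card C), alpha hp h ∈ S := by
  obtain ⟨w, hw⟩ := IsCyclic.exists_generator (α := C)
  simp only [IsRoquette, not_forall] at hR
  obtain ⟨A, hA, hAc, hcyc⟩ := hR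
  obtain ⟨x, hxA, hx⟩ : ∃ x ∈ A, (π x : MulAut C) ≠ 1 := by
    by_contra! hcon
    have hle : A ≤ ι.range := fun x hx => exists_ι_eq_of_coe_eq_one hexact (hcon x hx)
    have : IsCyclic ι.range := isCyclic_of_surjective _ ι.rangeRestrict_surjective
    exact hcyc (isCyclic_of_injective _ (Subgroup.inclusion_injective hle))
  have hunip : ∀ c, (π x : MulAut C) ((π x : MulAut C) c * c⁻¹) = (π x : MulAut C) c * c⁻¹ := by
    intro c
    apply hι
    rw [hconj, mul_inv_eq_iff_eq_mul]
    refine hAc _ hxA _ ?_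
    rw [map_mul, hconj, map_inv, mul_assoc, mul_assoc, ← mul_assoc (ι c)]
    exact mul_mem hxA (hA.conj_mem _ (inv_mem hxA) _)
  have hne : orderOf ((π x : MulAut C) w * w⁻¹) ≠ 1 := by
    rw [Ne, orderOf_eq_one_iff, mul_inv_eq_one]
    exact fun h1 => hx (mulAut_ext_of_generator hw h1)
  obtain ⟨p, hp, hpo⟩ := Nat.exists_prime_and_dvd hne
  obtain ⟨h, hmem⟩ := alpha_mem_zpowers_of_unipotent hw hunip hp hpo
  exact ⟨p, hp, h, (Subgroup.zpowers_le.2 (π x).2) hmem⟩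

/-- Let `c` be the `p`-part of a generator of `C`, where `p` is chosen such that `T` acts
nontrivially on it. As `T` contains no nontrivial element of `C`, the elements of `C`
normalizing `T` are those fixed by `T`. If `ι c` conjugates `t ∈ T` into `N_G(T)`, then
`(t - 1) c` is fixed by `T`, so `(t - 1) ^ 2 = 0` on the `p`-primary part, and the absence of `α_p`
forces `t` to act trivially on it. Hence the conjugate of `T` by `ι c` meets `N_G(T)` in a subgroup
of `T`. -/
theorem eq_bot_of_isExpansive (hι : Function.Injective ι)
    (hexact : ι.range = π.ker)
    (hconj : ∀ (g : G) (c : C), ι ((π g : MulAut C) c) = g * ι c * g⁻¹)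
    (hS : ∀ (p : ℕ) (hp : p.Prime) (h : p ^ 2 ∣ Nat.card C),
      alpha hp h ∉ S.map (proj hp))
    {T : Subgroup G} (hcore : T.normalCore = ⊥) (hT : IsExpansive T) : T = ⊥ := by
  obtain ⟨w, hw⟩ := IsCyclic.exists_generator (α := C)
  have htriv : ∀ c, ι c ∈ T → c = 1 := fun c hc => by
    have h1 : ι c ∈ T.normalCore := fun g => conj_ι_mem hconj hc g
    rw [hcore, Subgroup.mem_bot] at h1
    exact hι (h1.trans (map_one ι).symm)
  by_contra hbot
  obtain ⟨t₀, ht₀, ht₀1⟩ := T.bot_or_exists_ne_one.resolve_left hbot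
  have hfix : ∀ d, ι d ∈ Subgroup.normalizer (T : Set G) → ∀ t ∈ T, (π t : MulAut C) d = d := by
    intro d hd t ht
    have h1 : ι ((π t : MulAut C) d * d⁻¹) ∈ T := by
      rw [map_mul, hconj, map_inv, mul_assoc, mul_assoc, ← mul_assoc (ι d)]
      exact mul_mem ht ((Subgroup.mem_normalizer_iff.1 hd _).1 (inv_mem ht))
    exact mul_inv_eq_one.1 (htriv _ h1)
  have hne : orderOf ((π t₀ : MulAut C) w * w⁻¹) ≠ 1 := by
    rw [Ne, orderOf_eq_one_iff, mul_inv_eq_one]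
    intro h1
    obtain ⟨c, hc⟩ := exists_ι_eq_of_coe_eq_one hexact
      (mulAut_ext_of_generator hw h1 : (π t₀ : MulAut C) = 1)
    rw [← hc] at ht₀ ht₀1
    exact ht₀1 (by rw [htriv c ht₀, map_one])
  obtain ⟨p, hp, hpo⟩ := Nat.exists_prime_and_dvd hne
  have hδ : ∀ (σ : MulAut C) x, σ (pPart C p x) * (pPart C p x)⁻¹ = pPart C p (σ x * x⁻¹) :=
    fun σ x => by rw [map_mul, map_inv, pPart_map]
  have hcN : ι (pPart C p w) ∉ Subgroup.normalizer (T : Set G) := fun h1 =>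
    pPart_ne_one_of_dvd_orderOf hp hpo (by rw [← hδ, hfix _ h1 _ ht₀, mul_inv_cancel])
  have hle : T.map (MulAut.conj (ι (pPart C p w))).toMonoidHom ⊓
      Subgroup.normalizer (T : Set G) ≤ T := by
    rintro _ ⟨⟨t, ht, rfl⟩, hN⟩
    change ι _ * t * (ι _)⁻¹ ∈ Subgroup.normalizer (T : Set G) at hN
    change ι _ * t * (ι _)⁻¹ ∈ T
    have htN := Subgroup.le_normalizer (H := T) ht
    have hcomm : ι ((π t : MulAut C) (pPart C p w) * (pPart C p w)⁻¹) =
        t * (ι (pPart C p w) * t * (ι (pPart C p w))⁻¹)⁻¹ := by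
      rw [map_mul, hconj, map_inv]
      group
    have hf := hfix _ (hcomm ▸ mul_mem htN (inv_mem hN)) t ht
    obtain ⟨σ, hσS, hσt⟩ : ∃ σ ∈ S, (π t : MulAut C) = σ := ⟨_, (π t).2, rfl⟩
    rw [hσt] at hcomm hf
    have hσ : ∀ x, proj hp σ x * x⁻¹ = pPart C p (σ x * x⁻¹) := fun x => by
      rw [proj_apply, mul_inv_cancel_right, hδ]
    have hone : proj hp σ w * w⁻¹ = 1 := by
      by_contra hne1
      obtain ⟨q, hq, hqo⟩ := Nat.exists_prime_and_dvd (mt orderOf_eq_one_iff.1 hne1)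
      have hpk : (proj hp σ w * w⁻¹) ^ p ^ (Nat.card C).factorization p = 1 := by
        rw [hσ, pPart_pow hp]
      have hqp : q = p := (Nat.prime_dvd_prime_iff_eq hq hp).1
        (hq.dvd_of_dvd_pow (hqo.trans (orderOf_dvd_of_pow_eq_one hpk)))
      subst hqp
      -- It suffices to check `(σ - 1) ^ 2 = 0` on the generator, where it is `hf`.
      have hunip : ∀ x, proj hp σ (proj hp σ x * x⁻¹) = proj hp σ x * x⁻¹ := by
        intro x
        obtain ⟨i, rfl⟩ := hw x
        have hw1 : proj hp σ (proj hp σ w * w⁻¹) = proj hp σ w * w⁻¹ := by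
          rw [hσ w, proj_of_pow_eq_one hp _ (pPart_pow hp _), ← hδ, hf]
        simp only [map_zpow, ← inv_zpow, ← mul_zpow, hw1]
      obtain ⟨h, hmem⟩ := alpha_mem_zpowers_of_unipotent hw hunip hp hqo
      exact hS q hp h ((Subgroup.zpowers_le.2
        (Subgroup.mem_map_of_mem (proj hp) hσS)) hmem)
    rw [hσ, ← hδ] at hone
    rw [hone, map_one, eq_comm, mul_inv_eq_one] at hcomm
    exact hcomm ▸ ht
  refine absurd (hT _ hcN) (not_lt_of_ge ?_)
  exact (coreIn_le _ _).trans (sup_le hle le_rfl)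

end Extension

end CyclicExt

theorem mainTheorem2 {C G : Type*} [CommGroup C] [IsCyclic C] [Finite C] [Group G]
    (S : Subgroup (MulAut C)) (ι : C →* G) (π : G →* S)
    (hι : Function.Injective ι) (hπ : Function.Surjective π) (hexact : ι.range = π.ker)
    (hconj : ∀ (g : G) (c : C), ι ((π g : MulAut C) c) = g * ι c * g⁻¹)
    (htwo : (Nat.card C).factorization 2 ≠ 2) :
    (IsRoquette G →
      ∀ (p : ℕ) (hp : p.Prime) (h : p ^ 2 ∣ Nat.card C),
        ¬ Subgroup.zpowers (CyclicExt.alpha hp h) ≤ S) ∧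
    ((∀ (p : ℕ) (hp : p.Prime) (h : p ^ 2 ∣ Nat.card C),
        ¬ Subgroup.zpowers (CyclicExt.alpha hp h) ≤ S.map (CyclicExt.proj hp)) →
      ∀ T : Subgroup G, T.normalCore = ⊥ → IsExpansive T → T = ⊥) ∧
    ((∀ T : Subgroup G, T.normalCore = ⊥ → IsExpansive T → T = ⊥) → IsRoquette G) := by
  simp only [Subgroup.zpowers_le]
  refine ⟨fun hR p hp h hS => ?_, fun hS T hcore hT => ?_, fun hexp => ?_⟩
  · exact CyclicExt.not_isRoquette_of_alpha_mem hι hπ hexact hconj hp h (fun h2 => h2 ▸ htwo) hS hR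
  · exact CyclicExt.eq_bot_of_isExpansive hι hexact hconj hS hcore hT
  · by_contra hR
    obtain ⟨p, hp, h, hS⟩ := CyclicExt.exists_alpha_mem_of_not_isRoquette hι hexact hconj hR
    obtain ⟨T, hcore, hT, hne⟩ := CyclicExt.exists_isExpansive_of_alpha_mem hι hπ hexact hconj
      hp h (fun h2 => h2 ▸ htwo) hS
    exact hne (hexp T hcore hT)
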